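/- A Cantor real base is a sequence $B=(\beta_n)_{n\in\mathbb Z}$ of real numbers $\beta_n>1$ with $\prod_{n\ge 1}\beta_n=\prod_{n\ge 1}\beta_{-n}=+\infty$. A $B$-representation of a real number $x\ge 0$ is a sequence $(a_n)_{n\in\mathbb Z}$ of non-negative integers with $a_n=0$ for all sufficiently large $n$ and \[ x=\sum_{n\ge 0}a_n\,\beta_{n-1}\cdots\beta_0+\sum_{n\ge 1}\frac{a_{-n}}{\beta_{-1}\cdots\beta_{-n}} . \] The $B$-expansion of $x$ is its largest $B$-representation in the radix order, where $\mathbf a<\mathbf b$ if for some $i\in\mathbb Z$ one has $a_j=b_j$ for all $j>i$ and $a_i<b_i$. A $B$-integer is a number whose $B$-expansion satisfies $a_n=0$ for all $n<0$. An infinite word $w_0w_1w_2\cdots$ is the faithful coding of the $B$-integers if, when the $B$-integers are enumerated increasingly as $x_0<x_1<x_2<\cdots$, one has for all $m,n\ge 0$: $w_m=w_n$ if and only if $x_{m+1}-x_m=x_{n+1}-x_n$. Let $k\ge 2$. An infinite word over $\{0,\ldots,k-1\}$ is an Arnoux–Rauzy sequence if it is recurrent and, for every $n\ge0$, has exactly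 one left special factor and exactly one right special factor of length $n$, the former being extendable to the left, and the latter to the right, by each of the $k$ letters to a factor of the word (a factor is left, respectively right, special if at least two letters extend it in this way). It is standard if all its prefixes are left special. For $0\le i\le k-1$ let $L_i$ be the morphism of words over $\{0,\ldots,k-1\}$ with $L_i(i)=i$ and $L_i(j)=ij$ for $j\ne i$. A standard Arnoux–Rauzy sequence $\mathbf w$ over $\{0,\ldots,k-1\}$ is regular if \[ \mathbf w=\lim_{n\to\infty}L_{i_1}^{a_1}L_{i_2}^{a_2}\cdots L_{i_n}^{a_n}(0) \] (letter by letter) for some positive integers $a_1,a_2,\ldots$ and some sequence $(i_n)_{n\ge 1}$ in $\{0,\ldots,k-1\}$ that is purely periodic with period $k$ and contains every letter of $\{0,\ldots,k-1\}$. Then for every $k\ge2$, every regular Arnoux–Rauzy sequence over $\{0,\ldots,k-1\}$ is the faithful coding of the $B$-integers for some Cantor real base $B$. In particular, the same holds for every standard Sturmian sequence, i.e., for every standard Arnoux–Rauzy sequence over $\{0,1\}$. -/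

import Mathlib

open Filter

/-! ### Cantor real bases, `B`-expansions and `B`-integers -/

/-- A Cantor real base: a bi-infinite sequence of reals `β n > 1` such that both
`∏_{n ≥ 1} β n` and `∏_{n ≥ 1} β (-n)` diverge to infinity. -/
structure IsCantorRealBase (B : ℤ → ℝ) : Prop where
  one_lt : ∀ n, 1 < B n
  prod_pos : Tendsto (fun N : ℕ => ∏ n ∈ Finset.range N, B ((n : ℤ) + 1)) atTop atTop
  prod_neg : Tendsto (fun N : ℕ => ∏ n ∈ Finset.range N, B (-((n : ℤ) + 1))) atTop atTop

/-- The weight of the digit of index `n`: it is `β_{n-1} ⋯ β_0` for `n ≥ 0`, and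
`1 / (β_{-1} ⋯ β_{-m})` for `n = -m < 0`. -/
noncomputable def cantorWeight (B : ℤ → ℝ) : ℤ → ℝ
  | Int.ofNat n => ∏ i ∈ Finset.range n, B (i : ℤ)
  | Int.negSucc m => (∏ i ∈ Finset.range (m + 1), B (-((i : ℤ) + 1)))⁻¹

/-- The bi-infinite word `a` of nonnegative integers is a `B`-representation of `x`: its digits
vanish from some index on, and its evaluation is finite and equal to `x`. -/
def IsBRepresentation (B : ℤ → ℝ) (a : ℤ → ℕ) (x : ℝ) : Prop :=
  (∃ N : ℤ, ∀ n, N ≤ n → a n = 0) ∧ HasSum (fun n : ℤ => (a n : ℝ) * cantorWeight B n) x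

/-- The strict radix order on bi-infinite words. -/
def RadixLT (a b : ℤ → ℕ) : Prop :=
  ∃ i : ℤ, (∀ j, i < j → a j = b j) ∧ a i < b i

/-- `a` is the `B`-expansion of `x`: the largest `B`-representation of `x` in the radix order. -/
def IsBExpansion (B : ℤ → ℝ) (a : ℤ → ℕ) (x : ℝ) : Prop :=
  IsBRepresentation B a x ∧ ∀ b : ℤ → ℕ, IsBRepresentation B b x → b = a ∨ RadixLT b a

/-- The set of `B`-integers: the numbers whose `B`-expansion has no fractional part. -/
def bIntegers (B : ℤ → ℝ) : Set ℝ :=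
  {x | ∃ a : ℤ → ℕ, IsBExpansion B a x ∧ ∀ n : ℤ, n < 0 → a n = 0}

/-- The infinite word `w` is the faithful coding of the `B`-integers: enumerating the `B`-integers
increasingly as `x 0 < x 1 < ⋯`, the letter `w n` encodes the distance `x (n + 1) - x n`, with
precisely one letter for each distance. (The names of the letters are irrelevant.) -/
def IsFaithfulCoding {α : Type*} (B : ℤ → ℝ) (w : ℕ → α) : Prop :=
  ∃ x : ℕ → ℝ, StrictMono x ∧ Set.range x = bIntegers B ∧
    ∀ m n : ℕ, w m = w n ↔ x (m + 1) - x m = x (n + 1) - x n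

/-! ### Standard Arnoux–Rauzy sequences -/

/-- The factor `w n, w (n + 1), …, w (n + l - 1)` of length `l` of `w`. -/
def factorAt {α : Type*} (w : ℕ → α) (n l : ℕ) : List α :=
  (List.range l).map fun i => w (n + i)

/-- `u` occurs in `w`. -/
def IsFactor {α : Type*} (w : ℕ → α) (u : List α) : Prop :=
  ∃ n, factorAt w n u.length = u

/-- `u` has at least two left extensions that occur in `w`. -/
def IsLeftSpecial {α : Type*} (w : ℕ → α) (u : List α) : Prop :=
  ∃ a b : α, a ≠ b ∧ IsFactor w (a :: u) ∧ IsFactor w (b :: u)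

/-- `u` has at least two right extensions that occur in `w`. -/
def IsRightSpecial {α : Type*} (w : ℕ → α) (u : List α) : Prop :=
  ∃ a b : α, a ≠ b ∧ IsFactor w (u ++ [a]) ∧ IsFactor w (u ++ [b])

/-- Arnoux–Rauzy sequences over the alphabet `α`: recurrent, with exactly one left special and
exactly one right special factor of each length, both of which can be extended by every letter
of the alphabet. -/
structure IsArnouxRauzy {α : Type*} (w : ℕ → α) : Prop where
  recurrent : ∀ u, IsFactor w u → ∀ N, ∃ n, N ≤ n ∧ factorAt w n u.length = u
  left_unique : ∀ n : ℕ, ∃! u : List α, u.length = n ∧ IsLeftSpecial w u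
  right_unique : ∀ n : ℕ, ∃! u : List α, u.length = n ∧ IsRightSpecial w u
  left_ext : ∀ u, IsLeftSpecial w u → ∀ a : α, IsFactor w (a :: u)
  right_ext : ∀ u, IsRightSpecial w u → ∀ a : α, IsFactor w (u ++ [a])

/-- An Arnoux–Rauzy sequence is standard if its prefixes are left special. -/
structure IsStandardArnouxRauzy {α : Type*} (w : ℕ → α) : Prop extends IsArnouxRauzy w where
  prefix_left : ∀ l : ℕ, IsLeftSpecial w (factorAt w 0 l)

/-- A standard Sturmian sequence is a standard Arnoux–Rauzy sequence over a binary alphabet. -/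
def IsStandardSturmian (w : ℕ → Fin 2) : Prop :=
  IsStandardArnouxRauzy w

/-! ### Regular Arnoux–Rauzy sequences -/

/-- The morphism `L_i` of words over `{0, …, k-1}`: `i ↦ i`, and `j ↦ ij` for `j ≠ i`. -/
def arMorphism {k : ℕ} (i : Fin k) (u : List (Fin k)) : List (Fin k) :=
  u.flatMap fun j => if j = i then [i] else [i, j]

/-- The composition `ψ 0 ∘ ψ 1 ∘ ⋯ ∘ ψ (n - 1)`. -/
def composeFirst {β : Type*} (ψ : ℕ → β → β) : ℕ → β → β
  | 0 => id
  | n + 1 => composeFirst ψ n ∘ ψ n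

/-- The finite words `u n` converge (letter by letter) to the infinite word `w`. -/
def WordLimit {α : Type*} (u : ℕ → List α) (w : ℕ → α) : Prop :=
  ∀ j : ℕ, ∀ᶠ n in atTop, (u n)[j]? = some (w j)

/-- A standard Arnoux–Rauzy sequence over `{0, …, k-1}` is regular if it can be written as
`lim L_{i_0}^{a_0} L_{i_1}^{a_1} ⋯ L_{i_{n-1}}^{a_{n-1}} (0)`, with positive exponents `a_n` and a
sequence `(i_n)` that is purely periodic with period `k` and contains every letter. -/
def IsRegularArnouxRauzy {k : ℕ} [NeZero k] (w : ℕ → Fin k) : Prop :=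
  IsStandardArnouxRauzy w ∧
    ∃ (i : ℕ → Fin k) (a : ℕ → ℕ),
      (∀ n, 0 < a n) ∧ (∀ n, i (n + k) = i n) ∧ Function.Surjective i ∧
      WordLimit (fun n => composeFirst (fun m => (arMorphism (i m))^[a m]) n [0]) w

/-! The base is read off from lengths of words. Give each letter `j` a positive length `Δ j` and put
`W m`, the length of the block `arCompose i a m [i m]`, as the weight of digit `m`. If all these
blocks are prefixes of `w`, the partial sums of `Δ` along `w` should be the B-integers, and
injectivity of `Δ` makes the coding faithful. The blocks are self-similar: `arCompose i a (m + 1)`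
of a letter is either `a m` copies of the block of `i m` followed by one other block of level `m`,
or just the block of `i m`. A position in such a block is thus `q * W m` plus a position in a block
of level `m`, and by induction the positions are exactly the greedy sums below the length of the
block (`mem_startSet_arCompose`). This requires the lengths at each level to decrease cyclically
from `i m` on. Greedy sums are the B-integers as soon as every nonnegative real has a representation
(`bIntegers_eq_iUnion_greedySet`). The fractional places serve only this purpose, so they carry the
powers of a fixed `γ < 1`. For regular sequences the prefix blocks come from the limit; a standard
Sturmian sequence supplies them by repeated desubstitution, which uses only that its left special
factors are its prefixes. -/

/-! ### Greedy expansions -/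

/-- The numbers below `W m` whose greedy expansion with respect to the weights `W` only uses
the indices `0, …, m - 1`. -/
def greedySet (W : ℕ → ℝ) : ℕ → Set ℝ
  | 0 => {0}
  | m + 1 => {x | x < W (m + 1) ∧ ∃ q : ℕ, x - q * W m ∈ greedySet W m}

/-- The recursion peels off the top digit; unrolled, it bounds every lower partial sum by the next
weight. -/
theorem mem_greedySet_iff {W : ℕ → ℝ} (h0 : 0 < W 0) (m : ℕ) (x : ℝ) :
    x ∈ greedySet W m ↔ ∃ d : ℕ → ℕ, (∀ n, m ≤ n → d n = 0) ∧
      (∀ n, n ≤ m → ∑ j ∈ Finset.range n, (d j : ℝ) * W j < W n) ∧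
      x = ∑ j ∈ Finset.range m, (d j : ℝ) * W j := by
  induction m generalizing x with
  | zero =>
    constructor
    · intro hx
      refine ⟨fun _ => 0, by simp, ?_, by simpa [greedySet] using hx⟩
      intro n hn
      obtain rfl : n = 0 := by omega
      simpa using h0
    · rintro ⟨d, -, -, hx⟩
      simpa [greedySet] using hx
  | succ m ih =>
    constructor
    · rintro ⟨hlt, q, hq⟩
      obtain ⟨d, hd0, hd1, hd2⟩ := (ih _).1 hq
      have hsum : ∀ n, n ≤ m → ∑ j ∈ Finset.range n, (Function.update d m q j : ℝ) * W j =
          ∑ j ∈ Finset.range n, (d j : ℝ) * W j := by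
        intro n hn
        refine Finset.sum_congr rfl fun j hj => ?_
        rw [Function.update_of_ne (by have := Finset.mem_range.1 hj; omega)]
      have hx : x = ∑ j ∈ Finset.range (m + 1), (Function.update d m q j : ℝ) * W j := by
        rw [Finset.sum_range_succ, hsum m le_rfl, Function.update_self, ← hd2]
        ring
      refine ⟨Function.update d m q, ?_, ?_, hx⟩
      · intro n hn
        rw [Function.update_of_ne (by omega)]
        exact hd0 n (by omega)
      · intro n hn
        rcases Nat.lt_or_ge m n with h | h
        · obtain rfl : n = m + 1 := by omega
          rwa [← hx]
        · rw [hsum n h]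
          exact hd1 n h
    · rintro ⟨d, hd0, hd1, hx⟩
      refine ⟨hx ▸ hd1 _ le_rfl, d m, (ih _).2 ⟨fun j => if j < m then d j else 0, ?_, ?_, ?_⟩⟩
      · intro n hn
        simp [hn]
      · intro n hn
        have : ∑ j ∈ Finset.range n, (((if j < m then d j else 0 : ℕ) : ℝ)) * W j =
            ∑ j ∈ Finset.range n, (d j : ℝ) * W j :=
          Finset.sum_congr rfl fun j hj => by
            rw [if_pos (by have := Finset.mem_range.1 hj; omega)]
        rw [this]
        exact hd1 n (by omega)
      · rw [hx, Finset.sum_range_succ, add_sub_cancel_right]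
        exact Finset.sum_congr rfl fun j hj => by
          beta_reduce
          rw [if_pos (Finset.mem_range.1 hj)]

theorem greedySet_nonneg {W : ℕ → ℝ} (h : ∀ n, 0 < W n) {m : ℕ} {x : ℝ}
    (hx : x ∈ greedySet W m) : 0 ≤ x := by
  obtain ⟨d, -, -, rfl⟩ := (mem_greedySet_iff (h 0) m x).1 hx
  exact Finset.sum_nonneg fun j _ => mul_nonneg (Nat.cast_nonneg _) (h j).le

theorem greedySet_lt {W : ℕ → ℝ} (h0 : 0 < W 0) {m : ℕ} {x : ℝ}
    (hx : x ∈ greedySet W m) : x < W m := by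
  obtain ⟨d, -, hd, rfl⟩ := (mem_greedySet_iff h0 m x).1 hx
  exact hd m le_rfl

/-! ### B-integers as greedy sums -/

theorem cantorWeight_pos {B : ℤ → ℝ} (hB : ∀ n, 1 < B n) (n : ℤ) : 0 < cantorWeight B n := by
  have h : ∀ n, 0 < B n := fun n => one_pos.trans (hB n)
  rcases n with n | n
  · exact Finset.prod_pos fun i _ => h _
  · exact inv_pos.2 (Finset.prod_pos fun i _ => h _)

theorem exists_greatest_ne {a b : ℤ → ℕ} {M N : ℤ} (ha : ∀ n, M ≤ n → a n = 0)
    (hb : ∀ n, N ≤ n → b n = 0) (h : a ≠ b) : ∃ i, a i ≠ b i ∧ ∀ j, i < j → a j = b j := by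
  obtain ⟨n, hn⟩ := Function.ne_iff.1 h
  have hbdd : ∀ z : ℤ, a z ≠ b z → z ≤ max M N := by
    intro z hz
    by_contra! hlt
    exact hz (by rw [ha z (by omega), hb z (by omega)])
  obtain ⟨i, hi, hmax⟩ := Int.exists_greatest_of_bdd (P := fun z => a z ≠ b z) ⟨_, hbdd⟩ ⟨n, hn⟩
  refine ⟨i, hi, fun j hj => ?_⟩
  by_contra hne
  exact absurd (hmax j hne) (by omega)

theorem RadixLT.asymm {a b : ℤ → ℕ} (h : RadixLT a b) : ¬ RadixLT b a := by
  rintro ⟨i, hi, hi'⟩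
  obtain ⟨j, hj, hj'⟩ := h
  rcases lt_trichotomy i j with h | rfl | h
  · have := hi j h; omega
  · omega
  · have := hj i h; omega

/-- A sequence of digits on the nonnegative indices, extended by zeros. -/
def extendDigits (d : ℕ → ℕ) : ℤ → ℕ
  | Int.ofNat n => d n
  | Int.negSucc _ => 0

theorem extendDigits_natCast (d : ℕ → ℕ) (n : ℕ) : extendDigits d (n : ℤ) = d n := rfl

theorem extendDigits_neg (d : ℕ → ℕ) (n : ℕ) : extendDigits d (-((n : ℤ) + 1)) = 0 := by
  rw [← Int.negSucc_eq]
  rfl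

theorem hasSum_extendDigits (B : ℤ → ℝ) {d : ℕ → ℕ} {m : ℕ} (hd : ∀ n, m ≤ n → d n = 0) :
    HasSum (fun n : ℤ => (extendDigits d n : ℝ) * cantorWeight B n)
      (∑ j ∈ Finset.range m, (d j : ℝ) * cantorWeight B j) := by
  have h1 : HasSum (fun n : ℕ => (extendDigits d (n : ℤ) : ℝ) * cantorWeight B n)
      (∑ j ∈ Finset.range m, (d j : ℝ) * cantorWeight B j) := by
    refine hasSum_sum_of_ne_finset_zero fun n hn => ?_
    rw [extendDigits_natCast, hd n (by simpa using hn), Nat.cast_zero, zero_mul]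
  have h2 : HasSum (fun n : ℕ => (extendDigits d (-((n : ℤ) + 1)) : ℝ) *
      cantorWeight B (-((n : ℤ) + 1))) 0 := by
    simp only [extendDigits_neg, Nat.cast_zero, zero_mul]
    exact hasSum_zero
  rw [← add_zero (∑ j ∈ Finset.range m, (d j : ℝ) * cantorWeight B j)]
  exact HasSum.of_nat_of_neg_add_one h1 h2

/-- A representation that is larger from index `i` on gains at least one weight of index `i`, while
everything below `i` can lose only a greedy sum, which is smaller than that weight. So the values
differ. -/
theorem isBExpansion_of_greedy {B : ℤ → ℝ} (hB : ∀ n, 1 < B n) {d : ℕ → ℕ} {m : ℕ}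
    (hd : ∀ n, m ≤ n → d n = 0)
    (hlt : ∀ n : ℕ, ∑ j ∈ Finset.range n, (d j : ℝ) * cantorWeight B j < cantorWeight B n) :
    IsBExpansion B (extendDigits d) (∑ j ∈ Finset.range m, (d j : ℝ) * cantorWeight B j) := by
  have hW := cantorWeight_pos hB
  have hzero : ∀ n : ℤ, (m : ℤ) ≤ n → extendDigits d n = 0 := by
    rintro (n | n) hn
    · exact hd n (by simpa using hn)
    · rfl
  refine ⟨⟨⟨m, hzero⟩, hasSum_extendDigits B hd⟩, ?_⟩
  rintro b ⟨⟨N, hN⟩, hb⟩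
  by_cases hne : b = extendDigits d
  · exact Or.inl hne
  right
  obtain ⟨i, hi, hgt⟩ := exists_greatest_ne hN hzero hne
  refine ⟨i, hgt, ?_⟩
  by_contra! hge
  have hdiff := hb.sub (hasSum_extendDigits B hd)
  rw [sub_self] at hdiff
  -- The termwise minorant of `b - d`: one unit at `i`, minus the digits of `d` below `i`, and zero
  -- above.
  set c : ℕ → ℕ := fun j => if (j : ℤ) < i then d j else 0 with hc
  have hcsum := hasSum_extendDigits B (d := c) (m := i.toNat) (fun n hn => if_neg (by omega))
  have hlow := (hasSum_ite_eq i (cantorWeight B i)).sub hcsum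
  have hle := hasSum_le (fun n => ?_) hlow hdiff
  · refine absurd hle (not_le.2 (sub_pos.2 ?_))
    have hcd : ∑ j ∈ Finset.range i.toNat, (c j : ℝ) * cantorWeight B j =
        ∑ j ∈ Finset.range i.toNat, (d j : ℝ) * cantorWeight B j :=
      Finset.sum_congr rfl fun j hj => by
        have : (j : ℤ) < i := by have := Finset.mem_range.1 hj; omega
        rw [hc]
        beta_reduce
        rw [if_pos this]
    rw [hcd]
    rcases i with i | i
    · exact hlt i
    · simpa using hW (Int.negSucc i)
  · have hWn := hW n
    rcases lt_trichotomy n i with h | rfl | h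
    · have : extendDigits c n = extendDigits d n := by
        rcases n with n | n
        · exact if_pos h
        · rfl
      rw [if_neg h.ne, this]
      have : 0 ≤ (b n : ℝ) * cantorWeight B n := by positivity
      linarith
    · have hcn : extendDigits c n = 0 := by
        rcases n with n | n
        · exact if_neg (lt_irrefl _)
        · rfl
      have : (extendDigits d n : ℝ) + 1 ≤ b n := by exact_mod_cast (by omega)
      rw [if_pos rfl, hcn, Nat.cast_zero]
      nlinarith
    · have hcn : extendDigits c n = 0 := by
        rcases n with n | n
        · exact if_neg (not_lt.2 h.le)
        · rfl
      rw [if_neg h.ne', hcn, hgt n h]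
      simp

theorem cantorWeight_natCast (B : ℤ → ℝ) (n : ℕ) :
    cantorWeight B (n : ℤ) = ∏ i ∈ Finset.range n, B (i : ℤ) := rfl

theorem monotone_cantorWeight {B : ℤ → ℝ} (hB : ∀ n, 1 < B n) :
    Monotone fun n : ℕ => cantorWeight B (n : ℤ) := by
  refine monotone_nat_of_le_succ fun n => ?_
  rw [cantorWeight_natCast, cantorWeight_natCast, Finset.prod_range_succ]
  exact le_mul_of_one_le_right
    (Finset.prod_nonneg fun i _ => (one_pos.trans (hB _)).le) (hB _).le

theorem greedySet_subset_bIntegers {B : ℤ → ℝ} (hB : ∀ n, 1 < B n) (m : ℕ) :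
    greedySet (fun n : ℕ => cantorWeight B n) m ⊆ bIntegers B := by
  intro x hx
  obtain ⟨d, hd, hlt, rfl⟩ := (mem_greedySet_iff (cantorWeight_pos hB _) m x).1 hx
  refine ⟨extendDigits d, isBExpansion_of_greedy hB hd fun n => ?_, ?_⟩
  · rcases le_total n m with h | h
    · exact hlt n h
    · have : ∑ j ∈ Finset.range n, (d j : ℝ) * cantorWeight B j =
          ∑ j ∈ Finset.range m, (d j : ℝ) * cantorWeight B j := by
        refine (Finset.sum_subset (Finset.range_mono h) fun j _ hj => ?_).symm
        rw [hd j (by simpa using hj), Nat.cast_zero, zero_mul]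
      rw [this]
      exact (hlt m le_rfl).trans_le (monotone_cantorWeight hB h)
  · rintro (n | n) hn
    · exact absurd hn (by simp)
    · rfl

/-- If the digits below `n` were worth at least the weight of `n`, they could be exchanged for one
unit at `n` and a representation of the remainder. The result is larger in the radix order, even if
that representation also uses indices from `n` on. -/
theorem greedy_of_isBExpansion {B : ℤ → ℝ} (hrep : ∀ y : ℝ, 0 ≤ y → ∃ b, IsBRepresentation B b y)
    {a : ℤ → ℕ} {x : ℝ} (ha : IsBExpansion B a x) (hneg : ∀ n : ℤ, n < 0 → a n = 0) (n : ℕ) :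
    ∑ j ∈ Finset.range n, (a j : ℝ) * cantorWeight B j < cantorWeight B n := by
  by_contra! hge
  obtain ⟨b, ⟨N, hN⟩, hb⟩ := hrep _ (sub_nonneg.2 hge)
  obtain ⟨⟨⟨M, hM⟩, hsum⟩, hmax⟩ := ha
  set low : ℕ → ℕ := fun j => if j < n then a j else 0 with hlow
  have hlowsum := hasSum_extendDigits B (d := low) (m := n) (fun j hj => if_neg (by omega))
  have hlow_eq : ∑ j ∈ Finset.range n, (low j : ℝ) * cantorWeight B j =
      ∑ j ∈ Finset.range n, (a j : ℝ) * cantorWeight B j :=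
    Finset.sum_congr rfl fun j hj => by
      rw [hlow]
      beta_reduce
      rw [if_pos (Finset.mem_range.1 hj)]
  rw [hlow_eq] at hlowsum
  have hlow_of_ge : ∀ j : ℤ, (n : ℤ) ≤ j → extendDigits low j = 0 := by
    rintro (j | j) hj
    · exact if_neg (by simpa using hj)
    · rfl
  have hlow_of_lt : ∀ j : ℤ, j < n → extendDigits low j = a j := by
    rintro (j | j) hj
    · exact if_pos (by simpa using hj)
    · exact (hneg _ (Int.negSucc_lt_zero j)).symm
  -- The truncated subtraction is exact: `extendDigits low` agrees with `a` below `n` and vanishes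
  -- from `n` on.
  set a' : ℤ → ℕ := fun j => a j - extendDigits low j + (if j = n then 1 else 0) + b j with ha'
  have hge' : ∀ j : ℤ, (n : ℤ) ≤ j → a' j = a j + (if j = n then 1 else 0) + b j := by
    intro j hj
    rw [ha']
    beta_reduce
    rw [hlow_of_ge j hj, Nat.sub_zero]
  have hrep' : IsBRepresentation B a' x := by
    refine ⟨⟨max (max M N) (n + 1), fun j hj => ?_⟩, ?_⟩
    · rw [hge' j (by omega), hM j (by omega), hN j (by omega), if_neg (by omega)]
    · have h := ((hsum.sub hlowsum).add (hasSum_ite_eq (n : ℤ) (cantorWeight B n))).add hb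
      rw [sub_add_eq_add_sub, add_sub_assoc', sub_add_cancel, add_sub_cancel_right] at h
      refine (congrArg (fun f => HasSum f x) (funext fun j => ?_)).mpr h
      rw [ha']
      beta_reduce
      have hle : extendDigits low j ≤ a j := by
        rcases lt_or_ge j (n : ℤ) with hj | hj
        · exact (hlow_of_lt j hj).le
        · rw [hlow_of_ge j hj]; exact Nat.zero_le _
      push_cast [Nat.cast_sub hle]
      split_ifs with hj
      · subst hj; ring
      · ring
  have hlt : a n < a' n := by rw [hge' n le_rfl, if_pos rfl]; omega
  have hne : a ≠ a' := fun h => hlt.ne (congrFun h _)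
  obtain ⟨i, hi, hgt⟩ := exists_greatest_ne hM hrep'.1.choose_spec hne
  have hni : (n : ℤ) ≤ i := by
    by_contra! h
    exact hlt.ne (hgt n h)
  have hlt' : RadixLT a a' := ⟨i, hgt, by
    rw [hge' i hni] at hi ⊢
    omega⟩
  rcases hmax a' hrep' with h | h
  · exact hne h.symm
  · exact hlt'.asymm h

theorem bIntegers_eq_iUnion_greedySet {B : ℤ → ℝ} (hB : ∀ n, 1 < B n)
    (hrep : ∀ y : ℝ, 0 ≤ y → ∃ b, IsBRepresentation B b y) :
    bIntegers B = ⋃ m, greedySet (fun n : ℕ => cantorWeight B n) m := by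
  refine Set.Subset.antisymm ?_ (Set.iUnion_subset (greedySet_subset_bIntegers hB))
  rintro x ⟨a, ha, hneg⟩
  obtain ⟨⟨⟨M, hM⟩, hsum⟩, -⟩ := id ha
  have hd : ∀ n : ℕ, M.toNat ≤ n → a n = 0 := fun n hn => hM n (by omega)
  have hext : extendDigits (fun n : ℕ => a n) = a := by
    funext n
    rcases n with n | n
    · rfl
    · exact (hneg _ (Int.negSucc_lt_zero n)).symm
  have hsum' := hasSum_extendDigits B (d := fun n : ℕ => a n) hd
  rw [hext] at hsum'
  refine Set.mem_iUnion.2 ⟨M.toNat, (mem_greedySet_iff (cantorWeight_pos hB _) _ x).2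
    ⟨fun n => a n, hd, fun n _ => greedy_of_isBExpansion hrep ha hneg n, hsum.unique hsum'⟩⟩

/-! ### A base attached to a sequence of exponents -/

/-- The length of the block `ψ 0 ∘ ⋯ ∘ ψ (m - 1)` applied to the letter `i (m + t)`, for `t < k`. -/
noncomputable def stageLength (k : ℕ) (γ : ℝ) (a : ℕ → ℕ) : ℕ → ℕ → ℝ
  | 0, t => ∑ s ∈ Finset.range (k - t), γ ^ (s + 1)
  | m + 1, t =>
    if t + 1 < k then a m * stageLength k γ a m 0 + stageLength k γ a m (t + 1)
    else stageLength k γ a m 0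

/-- Normalizes the longest gap to 1, the weight of index 0; the other gaps are shorter partial sums,
hence distinct. -/
theorem exists_sum_pow_eq_one {k : ℕ} (hk : 2 ≤ k) :
    ∃ γ : ℝ, 0 < γ ∧ γ < 1 ∧ ∑ s ∈ Finset.range k, γ ^ (s + 1) = 1 := by
  have hk' : (2 : ℝ) ≤ k := by exact_mod_cast hk
  have hc : ContinuousOn (fun x : ℝ => ∑ s ∈ Finset.range k, x ^ (s + 1)) (Set.Icc 0 1) := by
    fun_prop
  obtain ⟨γ, ⟨h0, h1⟩, hγ⟩ := intermediate_value_Icc zero_le_one hc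
    (show (1 : ℝ) ∈ Set.Icc _ _ by simp; linarith)
  refine ⟨γ, lt_of_le_of_ne h0 ?_, lt_of_le_of_ne h1 ?_, hγ⟩
  · rintro rfl
    simp at hγ
  · rintro rfl
    simp at hγ
    linarith

section stageLength

variable {k : ℕ} {γ : ℝ} {a : ℕ → ℕ}

theorem stageLength_succ_of_lt {m t : ℕ} (ht : t + 1 < k) :
    stageLength k γ a (m + 1) t = a m * stageLength k γ a m 0 + stageLength k γ a m (t + 1) := by
  rw [stageLength, if_pos ht]

theorem stageLength_succ_of_eq {m t : ℕ} (ht : t + 1 = k) :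
    stageLength k γ a (m + 1) t = stageLength k γ a m 0 := by
  rw [stageLength, if_neg ht.not_lt]

theorem stageLength_zero_injOn (hγ : 0 < γ) {s t : ℕ} (hs : s < k) (ht : t < k)
    (h : stageLength k γ a 0 s = stageLength k γ a 0 t) : s = t := by
  have hmono : StrictMono fun n => ∑ s ∈ Finset.range n, γ ^ (s + 1) :=
    strictMono_nat_of_lt_succ fun n => by
      rw [Finset.sum_range_succ]
      exact lt_add_of_pos_right _ (pow_pos hγ _)
  have := hmono.injective h
  omega

/-- A bound uniform in the level: each weight then exceeds the previous one by at least `γ`, so the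
weights diverge. -/
theorem le_stageLength (hγ : 0 < γ) (m : ℕ) {t : ℕ} (ht : t < k) : γ ≤ stageLength k γ a m t := by
  induction m generalizing t with
  | zero =>
    rw [stageLength]
    have h := Finset.single_le_sum (f := fun s => γ ^ (s + 1)) (s := Finset.range (k - t))
      (fun s _ => (pow_pos hγ _).le) (Finset.mem_range.2 (Nat.sub_pos_of_lt ht))
    simpa using h
  | succ m ih =>
    have h0 := ih (t := 0) (by omega)
    rcases Nat.lt_or_ge (t + 1) k with h | h
    · rw [stageLength_succ_of_lt h]
      have := ih h
      have : 0 ≤ (a m : ℝ) * stageLength k γ a m 0 :=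
        mul_nonneg (Nat.cast_nonneg _) (hγ.le.trans h0)
      linarith
    · rwa [stageLength_succ_of_eq (by omega)]

theorem stageLength_pos (hγ : 0 < γ) (m : ℕ) {t : ℕ} (ht : t < k) : 0 < stageLength k γ a m t :=
  hγ.trans_le (le_stageLength hγ m ht)

/-- Positivity of the exponents enters at the last index, where a block of level `m + 1` containing
a copy of the block of `i m` is compared with that block alone. -/
theorem stageLength_succ_le (hγ : 0 < γ) (ha : ∀ n, 0 < a n) (m : ℕ) {t : ℕ} (ht : t + 1 < k) :
    stageLength k γ a m (t + 1) ≤ stageLength k γ a m t := by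
  induction m generalizing t with
  | zero =>
    rw [stageLength, stageLength]
    exact Finset.sum_le_sum_of_subset_of_nonneg (Finset.range_mono (by omega))
      fun s _ _ => (pow_pos hγ _).le
  | succ m ih =>
    rw [stageLength_succ_of_lt ht]
    rcases Nat.lt_or_ge (t + 2) k with h | h
    · rw [stageLength_succ_of_lt h]
      linarith [ih h]
    · rw [stageLength_succ_of_eq (by omega)]
      have h1 : (1 : ℝ) ≤ a m := by exact_mod_cast ha m
      have h2 := stageLength_pos (a := a) hγ m (show 0 < k by omega)
      have h3 := stageLength_pos (a := a) hγ m ht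
      nlinarith

theorem stageLength_le_zero (hγ : 0 < γ) (ha : ∀ n, 0 < a n) (m : ℕ) {t : ℕ} (ht : t < k) :
    stageLength k γ a m t ≤ stageLength k γ a m 0 := by
  induction t with
  | zero => exact le_rfl
  | succ t ih => exact (stageLength_succ_le hγ ha m ht).trans (ih (by omega))

theorem stageLength_add_le (hk : 2 ≤ k) (hγ : 0 < γ) (ha : ∀ n, 0 < a n) (m : ℕ) :
    stageLength k γ a m 0 + γ ≤ stageLength k γ a (m + 1) 0 := by
  rw [stageLength_succ_of_lt (by omega)]
  have h1 : (1 : ℝ) ≤ a m := by exact_mod_cast ha m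
  have h2 := stageLength_pos (a := a) hγ m (show 0 < k by omega)
  have h3 := le_stageLength (a := a) hγ m (show 0 + 1 < k by omega)
  nlinarith

theorem tendsto_stageLength (hk : 2 ≤ k) (hγ : 0 < γ) (ha : ∀ n, 0 < a n) :
    Tendsto (fun m => stageLength k γ a m 0) atTop atTop := by
  have h : ∀ m : ℕ, (m : ℝ) * γ ≤ stageLength k γ a m 0 := by
    intro m
    induction m with
    | zero => simpa using (stageLength_pos (a := a) hγ 0 (show 0 < k by omega)).le
    | succ m ih =>
      have := stageLength_add_le hk hγ ha m
      push_cast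
      linarith
  exact tendsto_atTop_mono h (tendsto_natCast_atTop_atTop.atTop_mul_const hγ)

end stageLength

/-- The base with weights `stageLength k γ a n 0` for `n ≥ 0` and `γ ^ n` for the index `-n`. -/
noncomputable def stageBase (k : ℕ) (γ : ℝ) (a : ℕ → ℕ) : ℤ → ℝ
  | Int.ofNat n => stageLength k γ a (n + 1) 0 / stageLength k γ a n 0
  | Int.negSucc _ => γ⁻¹

section stageBase

variable {k : ℕ} {γ : ℝ} {a : ℕ → ℕ}

theorem stageBase_natCast (n : ℕ) :
    stageBase k γ a n = stageLength k γ a (n + 1) 0 / stageLength k γ a n 0 := rfl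

theorem stageBase_neg (n : ℕ) : stageBase k γ a (-((n : ℤ) + 1)) = γ⁻¹ := by
  rw [← Int.negSucc_eq]
  rfl

theorem cantorWeight_stageBase_natCast (hk : 2 ≤ k) (hγ : 0 < γ)
    (hsum : ∑ s ∈ Finset.range k, γ ^ (s + 1) = 1) (n : ℕ) :
    cantorWeight (stageBase k γ a) n = stageLength k γ a n 0 := by
  rw [cantorWeight_natCast]
  induction n with
  | zero => rw [stageLength, Nat.sub_zero, hsum, Finset.prod_range_zero]
  | succ n ih =>
    rw [Finset.prod_range_succ, ih, stageBase_natCast,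
      mul_div_cancel₀ _ (stageLength_pos hγ n (by omega)).ne']

theorem cantorWeight_stageBase_neg (n : ℕ) :
    cantorWeight (stageBase k γ a) (-((n : ℤ) + 1)) = γ ^ (n + 1) := by
  rw [← Int.negSucc_eq]
  simp only [cantorWeight, stageBase_neg]
  simp

theorem isCantorRealBase_stageBase (hk : 2 ≤ k) (hγ : 0 < γ) (hγ1 : γ < 1) (ha : ∀ n, 0 < a n) :
    IsCantorRealBase (stageBase k γ a) := by
  have hpos : ∀ n, 0 < stageLength k γ a n 0 := fun n => stageLength_pos hγ n (by omega)
  refine ⟨?_, ?_, ?_⟩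
  · rintro (n | n)
    · exact (one_lt_div (hpos n)).2 (by linarith [stageLength_add_le hk hγ ha n])
    · exact (one_lt_inv₀ hγ).2 hγ1
  · have h : ∀ N : ℕ, ∏ n ∈ Finset.range N, stageBase k γ a ((n : ℤ) + 1) =
        stageLength k γ a (N + 1) 0 / stageLength k γ a 1 0 := by
      intro N
      induction N with
      | zero => simp [(hpos 1).ne']
      | succ N ih =>
        rw [Finset.prod_range_succ, ih, show (N : ℤ) + 1 = ((N + 1 : ℕ) : ℤ) by push_cast; rfl,
          stageBase_natCast, div_mul_div_comm, mul_comm, mul_div_mul_right _ _ (hpos _).ne']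
    simp only [h]
    exact ((tendsto_add_atTop_iff_nat 1).2 (tendsto_stageLength hk hγ ha)).atTop_div_const (hpos 1)
  · simp only [stageBase_neg, Finset.prod_const, Finset.card_range]
    exact tendsto_pow_atTop_atTop_of_one_lt ((one_lt_inv₀ hγ).2 hγ1)

/-- Expansions of the numbers in `[0, 1)` in base `γ⁻¹`. -/
theorem exists_hasSum_pow {γ : ℝ} (hγ : 0 < γ) (hγ1 : γ < 1) {r : ℝ} (h0 : 0 ≤ r) (h1 : r < 1) :
    ∃ d : ℕ → ℕ, HasSum (fun n => (d n : ℝ) * γ ^ (n + 1)) r := by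
  -- The Rényi map of base `γ⁻¹`; its orbit gives the digits, and the remainder after `N` digits is
  -- `γ ^ N * T^[N] r`.
  set T : ℝ → ℝ := fun x => Int.fract (γ⁻¹ * x) with hT
  have hTn : ∀ n, 0 ≤ T^[n] r ∧ T^[n] r < 1 := by
    intro n
    cases n with
    | zero => exact ⟨h0, h1⟩
    | succ n =>
      rw [Function.iterate_succ_apply']
      exact ⟨Int.fract_nonneg _, Int.fract_lt_one _⟩
  refine ⟨fun n => ⌊γ⁻¹ * T^[n] r⌋₊, ?_⟩
  have hpart : ∀ N, ∑ n ∈ Finset.range N, (⌊γ⁻¹ * T^[n] r⌋₊ : ℝ) * γ ^ (n + 1) =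
      r - γ ^ N * T^[N] r := by
    intro N
    induction N with
    | zero => simp
    | succ N ih =>
      have hnn : 0 ≤ γ⁻¹ * T^[N] r := mul_nonneg (inv_pos.2 hγ).le (hTn N).1
      have hf : T^[N + 1] r = γ⁻¹ * T^[N] r - ⌊γ⁻¹ * T^[N] r⌋₊ := by
        rw [Function.iterate_succ_apply', hT]
        beta_reduce
        rw [← Int.self_sub_floor, natCast_floor_eq_intCast_floor hnn]
      rw [Finset.sum_range_succ, ih, hf]
      field_simp
      ring
  rw [hasSum_iff_tendsto_nat_of_nonneg (fun n => by positivity)]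
  simp only [hpart]
  have hz : Tendsto (fun N => γ ^ N * T^[N] r) atTop (nhds 0) :=
    squeeze_zero (fun N => mul_nonneg (pow_nonneg hγ.le _) (hTn N).1)
      (fun N => mul_le_of_le_one_right (pow_nonneg hγ.le _) (hTn N).2.le)
      (tendsto_pow_atTop_nhds_zero_of_lt_one hγ.le hγ1)
  simpa using hz.const_sub r

/-- The digits `d 0, d 1, …` on the nonnegative indices and `e 0, e 1, …` on `-1, -2, …`. -/
def joinDigits (d e : ℕ → ℕ) : ℤ → ℕ
  | Int.ofNat n => d n
  | Int.negSucc n => e n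

theorem joinDigits_neg (d e : ℕ → ℕ) (n : ℕ) : joinDigits d e (-((n : ℤ) + 1)) = e n := by
  rw [← Int.negSucc_eq n]
  rfl

theorem exists_isBRepresentation_stageBase (hk : 2 ≤ k) (hγ : 0 < γ) (hγ1 : γ < 1)
    (hsum : ∑ s ∈ Finset.range k, γ ^ (s + 1) = 1) {y : ℝ} (hy : 0 ≤ y) :
    ∃ b, IsBRepresentation (stageBase k γ a) b y := by
  obtain ⟨d, hd⟩ := exists_hasSum_pow hγ hγ1 (Int.fract_nonneg y) (Int.fract_lt_one y)
  -- The integer part becomes a single digit at index 0, of weight 1; representations need not be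
  -- greedy.
  set e : ℕ → ℕ := fun n => if n = 0 then ⌊y⌋₊ else 0
  refine ⟨joinDigits e d, ⟨1, ?_⟩, ?_⟩
  · rintro (n | n) hn
    · exact if_neg (by simp at hn; omega)
    · exact absurd hn (by have := Int.negSucc_lt_zero n; omega)
  · have h1 : HasSum (fun n : ℕ => (joinDigits e d (n : ℤ) : ℝ) *
        cantorWeight (stageBase k γ a) n) ⌊y⌋₊ := by
      convert hasSum_ite_eq 0 (⌊y⌋₊ : ℝ) using 2 with n
      change (((if n = 0 then ⌊y⌋₊ else 0 : ℕ) : ℝ)) * _ = _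
      rw [cantorWeight_stageBase_natCast hk hγ hsum]
      split_ifs with h
      · rw [h, stageLength, Nat.sub_zero, hsum, mul_one]
      · simp
    have h2 : HasSum (fun n : ℕ => (joinDigits e d (-((n : ℤ) + 1)) : ℝ) *
        cantorWeight (stageBase k γ a) (-((n : ℤ) + 1))) (Int.fract y) := by
      simpa only [joinDigits_neg, cantorWeight_stageBase_neg] using hd
    have h3 := HasSum.of_nat_of_neg_add_one
      (f := fun n : ℤ => (joinDigits e d n : ℝ) * cantorWeight (stageBase k γ a) n) h1 h2
    rwa [natCast_floor_eq_intCast_floor hy, Int.floor_add_fract] at h3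

end stageBase

/-! ### Partial sums along words -/

section startSet

variable {α : Type*} (Δ : α → ℝ)

/-- The partial sums of the lengths `Δ` over the proper prefixes of a word. -/
def startSet : List α → Set ℝ
  | [] => ∅
  | a :: u => {x | x = 0 ∨ x - Δ a ∈ startSet u}

theorem mem_startSet_append (u v : List α) (x : ℝ) :
    x ∈ startSet Δ (u ++ v) ↔ x ∈ startSet Δ u ∨ x - (u.map Δ).sum ∈ startSet Δ v := by
  induction u generalizing x with
  | nil => simp [startSet]
  | cons a u ih =>
    simp only [List.cons_append, startSet, Set.mem_ofPred_eq, ih, List.map_cons, List.sum_cons,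
      or_assoc, sub_sub]

theorem startSet_singleton (a : α) : startSet Δ [a] = {0} := by
  ext x
  simp [startSet]

theorem factorAt_succ (w : ℕ → α) (n l : ℕ) :
    factorAt w n (l + 1) = factorAt w n l ++ [w (n + l)] := by
  simp [factorAt, List.range_succ]

theorem length_factorAt (w : ℕ → α) (n l : ℕ) : (factorAt w n l).length = l := by
  simp [factorAt]

theorem sum_map_factorAt_zero (w : ℕ → α) (l : ℕ) :
    ((factorAt w 0 l).map Δ).sum = ∑ j ∈ Finset.range l, Δ (w j) := by
  induction l with
  | zero => simp [factorAt]
  | succ l ih =>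
    rw [factorAt_succ, List.map_append, List.sum_append, ih, Finset.sum_range_succ]
    simp

theorem mem_startSet_factorAt_zero (w : ℕ → α) (l : ℕ) (x : ℝ) :
    x ∈ startSet Δ (factorAt w 0 l) ↔ ∃ n < l, x = ∑ j ∈ Finset.range n, Δ (w j) := by
  induction l with
  | zero => simp [factorAt, startSet]
  | succ l ih =>
    rw [factorAt_succ, mem_startSet_append, ih, sum_map_factorAt_zero, startSet_singleton,
      Set.mem_singleton_iff, sub_eq_zero, Nat.exists_lt_succ_right]

variable {Δ} {F : List α → List α} (hF : ∀ u v, F (u ++ v) = F u ++ F v)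
include hF

theorem sum_map_replicate_append (n : ℕ) (b c : α) :
    ((F (List.replicate n b ++ [c])).map Δ).sum =
      n * ((F [b]).map Δ).sum + ((F [c]).map Δ).sum := by
  induction n with
  | zero => simp
  | succ n ih =>
    rw [List.replicate_succ, List.cons_append, ← List.singleton_append, hF,
      List.map_append, List.sum_append, ih]
    push_cast
    ring

theorem mem_startSet_replicate_append (n : ℕ) (b c : α) (x : ℝ) :
    x ∈ startSet Δ (F (List.replicate n b ++ [c])) ↔
      (∃ q < n, x - (q : ℕ) * ((F [b]).map Δ).sum ∈ startSet Δ (F [b])) ∨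
        x - n * ((F [b]).map Δ).sum ∈ startSet Δ (F [c]) := by
  induction n generalizing x with
  | zero => simp
  | succ n ih =>
    rw [List.replicate_succ, List.cons_append, ← List.singleton_append, hF, mem_startSet_append, ih,
      ← or_assoc, Nat.exists_lt_succ_left]
    simp only [Nat.cast_zero, zero_mul, sub_zero, Nat.cast_add, Nat.cast_one, add_mul, one_mul,
      sub_sub, add_comm]

end startSet

/-! ### Blocks -/

section blocks

variable {k : ℕ}

theorem arMorphism_append (i : Fin k) (u v : List (Fin k)) :
    arMorphism i (u ++ v) = arMorphism i u ++ arMorphism i v := List.flatMap_append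

theorem iterate_map_append {α : Type*} {F : List α → List α}
    (hF : ∀ u v, F (u ++ v) = F u ++ F v) (n : ℕ) (u v : List α) :
    F^[n] (u ++ v) = F^[n] u ++ F^[n] v := by
  induction n generalizing u v with
  | zero => rfl
  | succ n ih => simp only [Function.iterate_succ_apply, hF, ih]

theorem iterate_arMorphism_self (i : Fin k) (n : ℕ) : (arMorphism i)^[n] [i] = [i] :=
  Function.iterate_fixed (by simp [arMorphism]) n

theorem iterate_arMorphism_of_ne {i j : Fin k} (h : j ≠ i) (n : ℕ) :
    (arMorphism i)^[n] [j] = List.replicate n i ++ [j] := by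
  induction n with
  | zero => rfl
  | succ n ih =>
    have h1 : arMorphism i [j] = [i] ++ [j] := by simp [arMorphism, h]
    rw [Function.iterate_succ_apply, h1, iterate_map_append (arMorphism_append i), ih,
      iterate_arMorphism_self, List.replicate_succ, List.singleton_append]
    rfl

/-- The composition `L_{i 0}^{a 0} ∘ ⋯ ∘ L_{i (n - 1)}^{a (n - 1)}`. -/
def arCompose (i : ℕ → Fin k) (a : ℕ → ℕ) (n : ℕ) : List (Fin k) → List (Fin k) :=
  composeFirst (fun m => (arMorphism (i m))^[a m]) n

variable {i : ℕ → Fin k} {a : ℕ → ℕ}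

theorem arCompose_append (n : ℕ) (u v : List (Fin k)) :
    arCompose i a n (u ++ v) = arCompose i a n u ++ arCompose i a n v := by
  induction n generalizing u v with
  | zero => rfl
  | succ n ih =>
    simp only [arCompose, composeFirst, Function.comp_apply] at ih ⊢
    rw [iterate_map_append (arMorphism_append _), ih]

theorem arCompose_succ_self (n : ℕ) : arCompose i a (n + 1) [i n] = arCompose i a n [i n] := by
  simp only [arCompose, composeFirst, Function.comp_apply, iterate_arMorphism_self]

theorem arCompose_succ_of_ne {n : ℕ} {j : Fin k} (h : j ≠ i n) :
    arCompose i a (n + 1) [j] = arCompose i a n (List.replicate (a n) (i n) ++ [j]) := by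
  simp only [arCompose, composeFirst, Function.comp_apply, iterate_arMorphism_of_ne h]

/-- A period of length `k` meeting all `k` letters meets each of them once. -/
theorem mod_eq_mod_of_periodic (hper : ∀ n, i (n + k) = i n) (hsurj : Function.Surjective i)
    {m n : ℕ} (h : i m = i n) : m % k = n % k := by
  have hk : 0 < k := Fin.pos (i 0)
  have hmod : ∀ n, i (n % k) = i n := Function.Periodic.map_mod_nat hper
  have hs : Function.Surjective fun n : Fin k => i n := fun j => by
    obtain ⟨n, rfl⟩ := hsurj j
    exact ⟨⟨n % k, Nat.mod_lt _ hk⟩, hmod n⟩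
  have hinj := Finite.injective_iff_surjective.2 hs
  have := hinj (a₁ := ⟨m % k, Nat.mod_lt _ hk⟩) (a₂ := ⟨n % k, Nat.mod_lt _ hk⟩)
    (by simpa only [hmod] using h)
  simpa using this

/-- Among the letters `i (m + 1), …, i (m + k)`, only the last equals `i m`, and `L_{i m}` fixes it.
-/
theorem arCompose_stage (hper : ∀ n, i (n + k) = i n) (hsurj : Function.Surjective i)
    (m : ℕ) {t : ℕ} :
    (t + 1 < k → arCompose i a (m + 1) [i (m + 1 + t)] =
      arCompose i a m (List.replicate (a m) (i m) ++ [i (m + (t + 1))])) ∧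
    (t + 1 = k → arCompose i a (m + 1) [i (m + 1 + t)] = arCompose i a m [i m]) := by
  constructor
  · intro h
    rw [arCompose_succ_of_ne, show m + 1 + t = m + (t + 1) by ring]
    intro heq
    have h1 := mod_eq_mod_of_periodic hper hsurj heq
    have h2 : (t + 1) ≡ 0 [MOD k] := Nat.ModEq.add_left_cancel' m
      (by rw [show m + (t + 1) = m + 1 + t by ring]; exact h1)
    have := Nat.le_of_dvd (by omega) ((Nat.modEq_zero_iff_dvd).1 h2)
    omega
  · intro h
    rw [show m + 1 + t = m + k by omega, hper, arCompose_succ_self]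

/-- The gaps: `Δ (i t) = stageLength k γ a 0 t` for `t < k`. -/
theorem exists_gaps (hper : ∀ n, i (n + k) = i n) (hsurj : Function.Surjective i)
    {γ : ℝ} (hγ : 0 < γ) (a : ℕ → ℕ) :
    ∃ Δ : Fin k → ℝ, Function.Injective Δ ∧ (∀ j, 0 < Δ j) ∧
      ∀ t < k, Δ (i t) = stageLength k γ a 0 t := by
  have hk : 0 < k := Fin.pos (i 0)
  have hex : ∀ j, ∃ t < k, i t = j := fun j => by
    obtain ⟨n, rfl⟩ := hsurj j
    exact ⟨n % k, Nat.mod_lt _ hk, Function.Periodic.map_mod_nat hper n⟩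
  choose t ht hit using hex
  refine ⟨fun j => stageLength k γ a 0 (t j), fun j j' h => ?_,
    fun j => stageLength_pos hγ 0 (ht j), fun s hs => ?_⟩
  · rw [← hit j, ← hit j', stageLength_zero_injOn hγ (ht j) (ht j') h]
  · have h := mod_eq_mod_of_periodic hper hsurj (hit (i s))
    rw [Nat.mod_eq_of_lt (ht _), Nat.mod_eq_of_lt hs] at h
    beta_reduce
    rw [h]

variable {γ : ℝ} {Δ : Fin k → ℝ}

theorem sum_map_arCompose (hper : ∀ n, i (n + k) = i n) (hsurj : Function.Surjective i)
    (hΔ : ∀ t < k, Δ (i t) = stageLength k γ a 0 t) (m : ℕ) {t : ℕ} (ht : t < k) :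
    ((arCompose i a m [i (m + t)]).map Δ).sum = stageLength k γ a m t := by
  induction m generalizing t with
  | zero =>
    rw [zero_add, ← hΔ t ht]
    simp [arCompose, composeFirst]
  | succ m ih =>
    obtain ⟨h1, h2⟩ := arCompose_stage (a := a) hper hsurj m (t := t)
    have h0 := ih (t := 0) (by omega)
    rw [add_zero] at h0
    rcases Nat.lt_or_ge (t + 1) k with h | h
    · rw [h1 h, sum_map_replicate_append (arCompose_append m), h0, ih h, stageLength_succ_of_lt h]
    · rw [h2 (by omega), h0, stageLength_succ_of_eq (by omega)]

/-! ### Positions in blocks and the coding of the B-integers -/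

theorem greedySet_mono {W : ℕ → ℝ} (h0 : 0 < W 0) {m : ℕ} (h : W m ≤ W (m + 1)) :
    greedySet W m ⊆ greedySet W (m + 1) := fun x hx =>
  ⟨(greedySet_lt h0 hx).trans_le h, 0, by simpa using hx⟩

/-- The number of complete copies of the block of `i m` before a position is its digit of index `m`.
The bound by the block's length limits this digit to `a m`, and when it equals `a m` the rest lies
in the final, shorter block. -/
theorem mem_startSet_arCompose (hk : 2 ≤ k) (hper : ∀ n, i (n + k) = i n)
    (hsurj : Function.Surjective i) (hγ : 0 < γ) (ha : ∀ n, 0 < a n)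
    (hΔ : ∀ t < k, Δ (i t) = stageLength k γ a 0 t) (m : ℕ) {t : ℕ} (ht : t < k) (x : ℝ) :
    x ∈ startSet Δ (arCompose i a m [i (m + t)]) ↔
      x ∈ greedySet (fun n => stageLength k γ a n 0) m ∧ x < stageLength k γ a m t := by
  have hW : ∀ n, 0 < stageLength k γ a n 0 := fun n => stageLength_pos hγ n (by omega)
  induction m generalizing t x with
  | zero =>
    have h : startSet Δ (arCompose i a 0 [i (0 + t)]) = {0} := startSet_singleton _ _
    rw [h]
    simp only [greedySet, Set.mem_singleton_iff]
    exact ⟨fun h => ⟨h, h ▸ stageLength_pos hγ 0 ht⟩, fun h => h.1⟩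
  | succ m ih =>
    obtain ⟨h1, h2⟩ := arCompose_stage (a := a) hper hsurj m (t := t)
    have hself : ∀ y, y ∈ startSet Δ (arCompose i a m [i m]) ↔
        y ∈ greedySet (fun n => stageLength k γ a n 0) m := fun y => by
      refine (ih (t := 0) (by omega) y).trans (and_iff_left_iff_imp.2 ?_)
      exact fun hy => greedySet_lt (W := fun n => stageLength k γ a n 0) (hW 0) hy
    have hlen := sum_map_arCompose hper hsurj hΔ m (show 0 < k by omega)
    rw [add_zero] at hlen
    rcases Nat.lt_or_ge (t + 1) k with h | h
    · have ih' : ∀ y, y ∈ startSet Δ (arCompose i a m [i (m + (t + 1))]) ↔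
          y ∈ greedySet (fun n => stageLength k γ a n 0) m ∧ y < stageLength k γ a m (t + 1) :=
        fun y => ih h y
      rw [h1 h, mem_startSet_replicate_append (arCompose_append m), hlen, ih',
        stageLength_succ_of_lt h]
      have hle : a m * stageLength k γ a m 0 + stageLength k γ a m (t + 1) ≤
          stageLength k γ a (m + 1) 0 := by
        rw [← stageLength_succ_of_lt h]
        exact stageLength_le_zero hγ ha (m + 1) ht
      have hpos := stageLength_pos (a := a) hγ m h
      have hW0 := hW m
      simp only [hself, greedySet, Set.mem_ofPred_eq]
      constructor
      · rintro (⟨q, hq, hx⟩ | ⟨hx, hlt⟩)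
        · have hlt := greedySet_lt (W := fun n => stageLength k γ a n 0) (hW 0) hx
          beta_reduce at hlt
          have hq' : (q : ℝ) + 1 ≤ a m := by exact_mod_cast hq
          have : x < a m * stageLength k γ a m 0 + stageLength k γ a m (t + 1) := by nlinarith
          exact ⟨⟨this.trans_le hle, q, hx⟩, this⟩
        · exact ⟨⟨by linarith, a m, hx⟩, by linarith⟩
      · rintro ⟨⟨-, q, hx⟩, hlt⟩
        have hnn := greedySet_nonneg (W := fun n => stageLength k γ a n 0) hW hx
        have hle' := stageLength_le_zero hγ ha m h
        -- The final block is no longer than `W m`, so `x < (a m + 1) * W m`.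
        have hq : q ≤ a m := by
          by_contra! hq
          have hq' : (a m : ℝ) + 1 ≤ q := by exact_mod_cast hq
          nlinarith
        rcases hq.lt_or_eq with hq | rfl
        · exact Or.inl ⟨q, hq, hx⟩
        · exact Or.inr ⟨hx, by linarith⟩
    · rw [h2 (by omega), hself, stageLength_succ_of_eq (by omega)]
      constructor
      · intro hx
        exact ⟨greedySet_mono (W := fun n => stageLength k γ a n 0) (hW 0)
          (by linarith [stageLength_add_le hk hγ ha m]) hx,
          greedySet_lt (W := fun n => stageLength k γ a n 0) (hW 0) hx⟩
      · rintro ⟨⟨-, q, hx⟩, hlt⟩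
        have hnn := greedySet_nonneg (W := fun n => stageLength k γ a n 0) hW hx
        have hq : q = 0 := by
          by_contra hq
          have hq' : (1 : ℝ) ≤ q := by exact_mod_cast Nat.one_le_iff_ne_zero.2 hq
          have := hW m
          nlinarith
        subst hq
        simpa using hx

theorem exists_isFaithfulCoding (hk : 2 ≤ k) (hper : ∀ n, i (n + k) = i n)
    (hsurj : Function.Surjective i) (ha : ∀ n, 0 < a n) {w : ℕ → Fin k}
    (hw : ∀ n, ∃ l, arCompose i a n [i n] = factorAt w 0 l) :
    ∃ B : ℤ → ℝ, IsCantorRealBase B ∧ IsFaithfulCoding B w := by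
  obtain ⟨γ, hγ, hγ1, hsum⟩ := exists_sum_pow_eq_one hk
  obtain ⟨Δ, hinj, hpos, hΔ⟩ := exists_gaps hper hsurj hγ a
  have hbase := isCantorRealBase_stageBase hk hγ hγ1 ha
  refine ⟨stageBase k γ a, hbase, fun n => ∑ j ∈ Finset.range n, Δ (w j),
    strictMono_nat_of_lt_succ fun n => ?_, ?_, fun m n => ?_⟩
  · rw [Finset.sum_range_succ]
    exact lt_add_of_pos_right _ (hpos _)
  · rw [bIntegers_eq_iUnion_greedySet hbase.one_lt
      fun y hy => exists_isBRepresentation_stageBase hk hγ hγ1 hsum hy]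
    simp only [cantorWeight_stageBase_natCast hk hγ hsum]
    have hset : ∀ m x, x ∈ greedySet (fun n => stageLength k γ a n 0) m ↔
        x ∈ startSet Δ (arCompose i a m [i m]) := fun m x => by
      have := mem_startSet_arCompose hk hper hsurj hγ ha hΔ m (show 0 < k by omega) x
      rw [add_zero] at this
      rw [this, iff_self_and]
      exact fun hx => greedySet_lt (W := fun n => stageLength k γ a n 0)
        (stageLength_pos hγ 0 (by omega)) hx
    ext x
    simp only [Set.mem_range, Set.mem_iUnion, hset]
    constructor
    -- Take a level whose prefix block is longer than the given partial sum; its positions include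
    -- that sum.
    · rintro ⟨n, rfl⟩
      obtain ⟨m, hm⟩ := ((tendsto_stageLength hk hγ ha).eventually_gt_atTop
        (∑ j ∈ Finset.range n, Δ (w j))).exists
      obtain ⟨l, hl⟩ := hw m
      refine ⟨m, ?_⟩
      have hlen := sum_map_arCompose hper hsurj hΔ m (show 0 < k by omega)
      rw [add_zero, hl, sum_map_factorAt_zero] at hlen
      rw [hl, mem_startSet_factorAt_zero]
      refine ⟨n, ?_, rfl⟩
      by_contra! hle
      rw [← hlen] at hm
      exact absurd hm (not_lt.2 (Finset.sum_le_sum_of_subset_of_nonneg (Finset.range_mono hle)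
        fun j _ _ => (hpos _).le))
    · rintro ⟨m, hm⟩
      obtain ⟨l, hl⟩ := hw m
      rw [hl, mem_startSet_factorAt_zero] at hm
      obtain ⟨n, -, hx⟩ := hm
      exact ⟨n, hx.symm⟩
  · rw [Finset.sum_range_succ_sub_sum, Finset.sum_range_succ_sub_sum]
    exact hinj.eq_iff.symm

theorem exists_isFaithfulCoding_of_isRegularArnouxRauzy [NeZero k] (hk : 2 ≤ k) {w : ℕ → Fin k}
    (hw : IsRegularArnouxRauzy w) : ∃ B : ℤ → ℝ, IsCantorRealBase B ∧ IsFaithfulCoding B w := by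
  obtain ⟨-, i, a, ha, hper, hsurj, hlim⟩ := hw
  refine exists_isFaithfulCoding hk hper hsurj ha fun n => ?_
  -- As `a n > 0`, the block of `i (n + 1)` at level `n + 1` begins with the block of `i n` at level
  -- `n`.
  have hprefix : ∀ m n, m ≤ n → arCompose i a m [i m] <+: arCompose i a n [i n] := by
    intro m n hmn
    induction n, hmn using Nat.le_induction with
    | base => exact List.prefix_rfl
    | succ n _ ih =>
      refine ih.trans ?_
      rw [(arCompose_stage hper hsurj n (t := 0)).1 (by omega),
        show a n = a n - 1 + 1 by have := ha n; omega, List.replicate_succ, List.cons_append,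
        ← List.singleton_append (l := _ ++ _), arCompose_append n [i n]]
      exact List.prefix_append _ _
  refine ⟨(arCompose i a n [i n]).length, List.ext_getElem? fun j => ?_⟩
  rcases Nat.lt_or_ge j (arCompose i a n [i n]).length with hj | hj
  · obtain ⟨N, hN⟩ := eventually_atTop.1 (hlim j)
    obtain ⟨z, hz⟩ := hsurj 0
    -- The limit is taken along the letter 0, so a late level is needed at which `i` takes this
    -- value.
    have hz' : i (z + (max N n) * k) = 0 := by
      rw [← hz]
      exact Function.Periodic.nat_mul hper _ z
    have hle : max N n ≤ z + max N n * k := by nlinarith [Nat.zero_le (max N n)]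
    have h1 := hN _ ((le_max_left N n).trans hle)
    have h2 := hprefix n _ ((le_max_right N n).trans hle)
    rw [hz'] at h2
    change (arCompose i a _ [0])[j]? = _ at h1
    have h3 : (arCompose i a n [i n])[j]? = some (w j) := by
      rw [← h1, List.getElem?_eq_getElem hj, h2.getElem hj, List.getElem?_eq_getElem]
    rw [h3]
    simp [factorAt, hj]
  · rw [List.getElem?_eq_none hj, List.getElem?_eq_none (by rwa [length_factorAt])]

end blocks

/-! ### Desubstitution of standard Sturmian sequences -/

/-- The word `u` occurs in `w` at the position `n`. -/
def OccursAt {α : Type*} (w : ℕ → α) (n : ℕ) (u : List α) : Prop :=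
  factorAt w n u.length = u

section OccursAt

variable {α : Type*} {w : ℕ → α}

theorem occursAt_nil (n : ℕ) : OccursAt w n [] := rfl

theorem occursAt_cons {n : ℕ} {a : α} {u : List α} :
    OccursAt w n (a :: u) ↔ w n = a ∧ OccursAt w (n + 1) u := by
  simp only [OccursAt, factorAt, List.length_cons, List.range_succ_eq_map, List.map_cons,
    List.map_map, List.cons.injEq, add_zero]
  simp only [Function.comp_def, Nat.succ_eq_add_one, Nat.add_assoc, Nat.add_comm 1]

theorem occursAt_append_left {n : ℕ} {u v : List α} (h : OccursAt w n (u ++ v)) :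
    OccursAt w n u := by
  induction u generalizing n with
  | nil => exact occursAt_nil n
  | cons a u ih =>
    rw [List.cons_append, occursAt_cons] at h
    exact occursAt_cons.2 ⟨h.1, ih h.2⟩

theorem isFactor_cons {a : α} {u : List α} :
    IsFactor w (a :: u) ↔ ∃ n, w n = a ∧ OccursAt w (n + 1) u :=
  exists_congr fun _ => occursAt_cons

end OccursAt

/-- The left special factors of `w` are exactly its prefixes. -/
def LeftSpecialIffPrefix {α : Type*} (w : ℕ → α) : Prop :=
  ∀ u, IsLeftSpecial w u ↔ OccursAt w 0 u

theorem IsStandardArnouxRauzy.leftSpecialIffPrefix {α : Type*} {w : ℕ → α}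
    (hw : IsStandardArnouxRauzy w) : LeftSpecialIffPrefix w := by
  refine fun u => ⟨fun h => ?_, fun h => ?_⟩
  · exact (hw.left_unique u.length).unique ⟨length_factorAt _ _ _, hw.prefix_left _⟩ ⟨rfl, h⟩
  · rw [← h]
    exact hw.prefix_left _

/-- The starting position in `w` of the `n`-th block, the blocks being `cd` and `c`. -/
def blockStart {α : Type*} [DecidableEq α] (w : ℕ → α) (d : α) : ℕ → ℕ
  | 0 => 0
  | n + 1 => blockStart w d n + if w (blockStart w d n + 1) = d then 2 else 1

/-- The sequence coding the blocks of `w`. -/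
def desubstitute {α : Type*} [DecidableEq α] (w : ℕ → α) (d : α) (n : ℕ) : α :=
  w (blockStart w d n + 1)

section desubstitute

variable {w : ℕ → Fin 2} {c d : Fin 2}

theorem eq_or_eq_of_ne (hcd : c ≠ d) (x : Fin 2) : x = c ∨ x = d := by
  omega

theorem LeftSpecialIffPrefix.exists_eq (hw : LeftSpecialIffPrefix w) (x : Fin 2) :
    ∃ n, w n = x := by
  obtain ⟨a, b, hab, ⟨m, hm⟩, ⟨n, hn⟩⟩ := (hw []).2 (occursAt_nil 0)
  have h1 := (occursAt_cons.1 hm).1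
  have h2 := (occursAt_cons.1 hn).1
  rcases eq_or_eq_of_ne hab x with rfl | rfl
  · exact ⟨m, h1⟩
  · exact ⟨n, h2⟩

theorem LeftSpecialIffPrefix.exists_first (hw : LeftSpecialIffPrefix w) (hcd : c ≠ d) :
    ∃ n, w n = d ∧ ∀ m < n, w m = c := by
  have h := hw.exists_eq d
  exact ⟨Nat.find h, Nat.find_spec h, fun m hm =>
    (eq_or_eq_of_ne hcd _).resolve_right (Nat.find_min h hm)⟩

/-- The first `d` is preceded by `c`; a factor `dd` would make `d` left special, hence a prefix. -/
theorem LeftSpecialIffPrefix.not_consecutive (hw : LeftSpecialIffPrefix w) (hcd : c ≠ d)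
    (h0 : w 0 = c) (n : ℕ) (h1 : w n = d) : w (n + 1) = c := by
  refine (eq_or_eq_of_ne hcd _).resolve_right fun h2 => ?_
  obtain ⟨m, hm, hlt⟩ := hw.exists_first hcd
  obtain _ | m := m
  · exact hcd (h0 ▸ hm)
  have hs : IsLeftSpecial w [d] := ⟨c, d, hcd,
    isFactor_cons.2 ⟨m, hlt m (Nat.lt_succ_self m), occursAt_cons.2 ⟨hm, occursAt_nil _⟩⟩,
    isFactor_cons.2 ⟨n, h1, occursAt_cons.2 ⟨h2, occursAt_nil _⟩⟩⟩
  exact hcd (h0.symm.trans (occursAt_cons.1 ((hw _).1 hs)).1)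

theorem blockStart_succ_of_eq {n : ℕ} (h : desubstitute w d n = d) :
    blockStart w d (n + 1) = blockStart w d n + 2 := by
  exact congrArg (blockStart w d n + ·) (if_pos h)

theorem blockStart_succ_of_ne {n : ℕ} (h : desubstitute w d n ≠ d) :
    blockStart w d (n + 1) = blockStart w d n + 1 := by
  exact congrArg (blockStart w d n + ·) (if_neg h)

theorem apply_blockStart (hw : LeftSpecialIffPrefix w) (hcd : c ≠ d) (h0 : w 0 = c) (n : ℕ) :
    w (blockStart w d n) = c := by
  cases n with
  | zero => exact h0
  | succ n =>
    by_cases h : desubstitute w d n = d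
    · rw [blockStart_succ_of_eq h]
      exact hw.not_consecutive hcd h0 _ h
    · rw [blockStart_succ_of_ne h]
      exact (eq_or_eq_of_ne hcd _).resolve_right h

theorem exists_blockStart (m : ℕ) :
    ∃ n, m = blockStart w d n ∨ (m = blockStart w d n + 1 ∧ w m = d) := by
  induction m with
  | zero => exact ⟨0, Or.inl rfl⟩
  | succ m ih =>
    obtain ⟨n, rfl | ⟨rfl, h⟩⟩ := ih
    · by_cases h : desubstitute w d n = d
      · exact ⟨n, Or.inr ⟨rfl, h⟩⟩
      · exact ⟨n + 1, Or.inl (blockStart_succ_of_ne h).symm⟩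
    · exact ⟨n + 1, Or.inl (blockStart_succ_of_eq h).symm⟩

/-- Both blocks `c` and `cd` end in the letter coding them, so left extensions survive
desubstitution. -/
theorem exists_blockStart_succ_eq (hw : LeftSpecialIffPrefix w) (hcd : c ≠ d) (h0 : w 0 = c)
    (n : ℕ) : ∃ m, blockStart w d (n + 1) = m + 1 ∧ w m = desubstitute w d n := by
  by_cases h : desubstitute w d n = d
  · exact ⟨_, blockStart_succ_of_eq h, rfl⟩
  · refine ⟨_, blockStart_succ_of_ne h, ?_⟩
    rw [apply_blockStart hw hcd h0]
    exact ((eq_or_eq_of_ne hcd _).resolve_right h).symm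

theorem arMorphism_cons_self (u : List (Fin 2)) : arMorphism c (c :: u) = c :: arMorphism c u := by
  simp [arMorphism]

theorem arMorphism_cons_of_ne (hcd : c ≠ d) (u : List (Fin 2)) :
    arMorphism c (d :: u) = c :: d :: arMorphism c u := by
  simp [arMorphism, hcd.symm]

theorem apply_eq_of_occursAt_arMorphism {n : ℕ} {u : List (Fin 2)}
    (h : OccursAt w n (arMorphism c u ++ [c])) : w n = c := by
  cases u with
  | nil => exact (occursAt_cons.1 h).1
  | cons a u =>
    by_cases ha : c = a
    · subst ha
      rw [arMorphism_cons_self] at h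
      exact (occursAt_cons.1 h).1
    · rw [arMorphism_cons_of_ne ha] at h
      exact (occursAt_cons.1 h).1

/-- The trailing `c` is the start of the next block; it makes decoding unambiguous by telling a
final block `c` from `cd`. -/
theorem occursAt_desubstitute (hw : LeftSpecialIffPrefix w) (hcd : c ≠ d) (h0 : w 0 = c)
    (u : List (Fin 2)) (n : ℕ) :
    OccursAt (desubstitute w d) n u ↔
      OccursAt w (blockStart w d n) (arMorphism c u ++ [c]) := by
  have hstart := apply_blockStart hw hcd h0
  induction u generalizing n with
  | nil =>
    exact iff_of_true (occursAt_nil n) (occursAt_cons.2 ⟨hstart n, occursAt_nil _⟩)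
  | cons a u ih =>
    rw [occursAt_cons, propext (ih (n + 1))]
    rcases eq_or_eq_of_ne hcd a with rfl | rfl
    · rw [arMorphism_cons_self, List.cons_append, occursAt_cons, and_iff_right (hstart n)]
      constructor
      · rintro ⟨h, h'⟩
        rwa [blockStart_succ_of_ne (by rwa [h])] at h'
      · intro h
        have h1 : w (blockStart w d n + 1) = a := apply_eq_of_occursAt_arMorphism h
        change desubstitute w d n = a at h1
        exact ⟨h1, by rwa [blockStart_succ_of_ne (by rwa [h1])]⟩
    · rw [arMorphism_cons_of_ne hcd, List.cons_append, List.cons_append, occursAt_cons,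
        occursAt_cons, and_iff_right (hstart n)]
      exact and_congr_right fun h => by rw [blockStart_succ_of_eq h]

/-- An occurrence of `arMorphism c u ++ [c]` starts with `c`, so it starts at a block boundary, and
the letter before it codes the preceding block. -/
theorem isFactor_cons_desubstitute (hw : LeftSpecialIffPrefix w) (hcd : c ≠ d) (h0 : w 0 = c)
    (a : Fin 2) (u : List (Fin 2)) :
    IsFactor (desubstitute w d) (a :: u) ↔ IsFactor w (a :: (arMorphism c u ++ [c])) := by
  rw [isFactor_cons, isFactor_cons]
  constructor
  · rintro ⟨n, hn, hu⟩
    obtain ⟨m, hm, hm'⟩ := exists_blockStart_succ_eq hw hcd h0 n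
    exact ⟨m, hm'.trans hn, hm ▸ (occursAt_desubstitute hw hcd h0 u _).1 hu⟩
  · rintro ⟨m, hm, hu⟩
    have hc := apply_eq_of_occursAt_arMorphism hu
    obtain ⟨n, hn | ⟨-, hd⟩⟩ := exists_blockStart (w := w) (d := d) (m + 1)
    · obtain _ | n := n
      · exact absurd hn (Nat.succ_ne_zero m)
      obtain ⟨m', hm', hw'⟩ := exists_blockStart_succ_eq hw hcd h0 n
      obtain rfl : m = m' := by omega
      exact ⟨n, hw'.symm.trans hm, (occursAt_desubstitute hw hcd h0 u _).2 (hn ▸ hu)⟩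
    · exact absurd (hc.symm.trans hd) hcd

theorem LeftSpecialIffPrefix.desubstitute (hw : LeftSpecialIffPrefix w) (hcd : c ≠ d)
    (h0 : w 0 = c) : LeftSpecialIffPrefix (desubstitute w d) := by
  intro u
  rw [occursAt_desubstitute hw hcd h0 u 0]
  refine Iff.trans ?_ (hw _)
  simp only [IsLeftSpecial, isFactor_cons_desubstitute hw hcd h0]

theorem blockStart_eq_self {n : ℕ} (hcd : c ≠ d) (hlt : ∀ m ≤ n, w m = c) {m : ℕ} (hm : m ≤ n) :
    blockStart w d m = m := by
  induction m with
  | zero => rfl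
  | succ m ih =>
    rw [blockStart, ih (by omega), if_neg]
    rw [hlt _ hm]
    exact hcd

/-- Each desubstitution strips one letter from the initial run of `c`, so `n` of them bring the
first `d` to the front. -/
theorem exists_iterate_desubstitute (hcd : c ≠ d) (n : ℕ) (hw : LeftSpecialIffPrefix w)
    (hn : w n = d) (hlt : ∀ m < n, w m = c) :
    ∃ w' : ℕ → Fin 2, LeftSpecialIffPrefix w' ∧ w' 0 = d ∧
      ∀ u, OccursAt w' 0 u → OccursAt w 0 ((arMorphism c)^[n] u) := by
  induction n generalizing w with
  | zero => exact ⟨w, hw, hn, fun u h => h⟩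
  | succ n ih =>
    have h0 : w 0 = c := hlt 0 n.succ_pos
    have hself : ∀ m ≤ n, desubstitute w d m = w (m + 1) := fun m hm => by
      rw [desubstitute, blockStart_eq_self hcd (fun m hm => hlt m (Nat.lt_succ_of_le hm)) hm]
    obtain ⟨w', hw', h0', hocc⟩ := ih (hw.desubstitute hcd h0) ((hself n le_rfl).trans hn)
      fun m hm => (hself m hm.le).trans (hlt _ (Nat.succ_lt_succ hm))
    refine ⟨w', hw', h0', fun u hu => ?_⟩
    rw [Function.iterate_succ_apply']
    exact occursAt_append_left ((occursAt_desubstitute hw hcd h0 _ 0).1 (hocc u hu))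

theorem LeftSpecialIffPrefix.exists_desubstitution (hw : LeftSpecialIffPrefix w) :
    ∃ (n : ℕ) (w' : ℕ → Fin 2), 0 < n ∧ LeftSpecialIffPrefix w' ∧ w' 0 = w 0 + 1 ∧
      ∀ u, OccursAt w' 0 u → OccursAt w 0 ((arMorphism (w 0))^[n] u) := by
  have hcd : w 0 ≠ w 0 + 1 := by omega
  obtain ⟨n, hn, hlt⟩ := hw.exists_first hcd
  obtain ⟨w', h1, h2, h3⟩ := exists_iterate_desubstitute hcd n hw hn hlt
  refine ⟨n, w', Nat.pos_of_ne_zero ?_, h1, h2, h3⟩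
  rintro rfl
  exact hcd hn

end desubstitute

theorem exists_isFaithfulCoding_of_isStandardSturmian {w : ℕ → Fin 2} (hw : IsStandardSturmian w) :
    ∃ B : ℤ → ℝ, IsCantorRealBase B ∧ IsFaithfulCoding B w := by
  have hstep : ∀ v : {v : ℕ → Fin 2 // LeftSpecialIffPrefix v}, ∃ (n : ℕ)
      (v' : {v : ℕ → Fin 2 // LeftSpecialIffPrefix v}), 0 < n ∧ v'.1 0 = v.1 0 + 1 ∧
        ∀ u, OccursAt v'.1 0 u → OccursAt v.1 0 ((arMorphism (v.1 0))^[n] u) := by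
    rintro ⟨v, hv⟩
    obtain ⟨n, v', h1, h2, h3, h4⟩ := hv.exists_desubstitution
    exact ⟨n, ⟨v', h2⟩, h1, h3, h4⟩
  choose N next hpos hletter hocc using hstep
  -- Maximal runs are desubstituted in turn. The first letter changes each time, so the directive
  -- letters alternate and have period 2.
  set W : ℕ → {v : ℕ → Fin 2 // LeftSpecialIffPrefix v} :=
    fun n => next^[n] ⟨w, IsStandardArnouxRauzy.leftSpecialIffPrefix hw⟩ with hW
  have hsucc : ∀ n, W (n + 1) = next (W n) := fun n => Function.iterate_succ_apply' _ _ _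
  set i : ℕ → Fin 2 := fun n => (W n).1 0 with hi
  have hi1 : ∀ n, i (n + 1) = i n + 1 := fun n => by
    simp only [hi, hsucc, hletter]
  refine exists_isFaithfulCoding (i := i) (a := fun n => N (W n)) le_rfl (fun n => ?_)
    (fun j => ?_) (fun n => hpos _) fun n => ⟨_, Eq.symm (?_ : OccursAt w 0 _)⟩
  · rw [hi1, hi1]
    omega
  · rcases eq_or_eq_of_ne (c := i 0) (d := i 0 + 1) (by omega) j with h | h
    · exact ⟨0, h.symm⟩
    · exact ⟨1, (hi1 0).trans h.symm⟩
  · have h : ∀ n u, OccursAt (W n).1 0 u →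
        OccursAt w 0 (arCompose i (fun n => N (W n)) n u) := by
      intro n
      induction n with
      | zero => exact fun u hu => hu
      | succ n ih =>
        intro u hu
        rw [hsucc] at hu
        exact ih _ (hocc _ u hu)
    exact h n _ (occursAt_cons.2 ⟨rfl, occursAt_nil _⟩)

theorem mainTheorem8 :
    (∀ (k : ℕ) [NeZero k], 2 ≤ k → ∀ w : ℕ → Fin k, IsRegularArnouxRauzy w →
      ∃ B : ℤ → ℝ, IsCantorRealBase B ∧ IsFaithfulCoding B w) ∧
    (∀ w : ℕ → Fin 2, IsStandardSturmian w →
      ∃ B : ℤ → ℝ, IsCantorRealBase B ∧ IsFaithfulCoding B w) :=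
  ⟨fun _ _ hk _ hw => exists_isFaithfulCoding_of_isRegularArnouxRauzy hk hw,
    fun _ hw => exists_isFaithfulCoding_of_isStandardSturmian hw⟩
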